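/- Let $\|\cdot\|$ be a strictly convex norm on $\mathbb{R}^n$, let $f:\mathbb{R}^n\to\mathbb{R}^n$ be $C^1$, and let $X\subseteq\mathbb{R}^n$ be a convex set (for example $X=\mathbb{R}^n$) that is forward invariant for $\dot x=f(x)$, such that for every $x\in X$ the solution $\phi_t(x)$ starting at $x$ is defined for all $t\ge 0$. Suppose that the system is nonexpansive on $X$, that is, $\|\phi_t(x)-\phi_t(y)\|\le\|x-y\|$ for all $t>0$ and $x,y\in X$, and that at least one trajectory in $X$ is bounded, that is, $\{\phi_t(x):t\ge 0\}$ is bounded for some $x\in X$. Write $\omega(x)=\bigcap_{t\ge 0}\overline{\{\phi_s(x):s\ge t\}}$. Then: 1. Every trajectory $\{\phi_t(x):t\ge 0\}$, $x\in X$, is bounded. 2. There are an equilibrium $p\in\mathbb{R}^n$ (so $f(p)=0$) and a linear map $B$ on $\mathbb{R}^n$ such that the linear system $\dot x=Bx$ is conserved (all of its forward trajectories are bounded and no trajectory other than the zero one converges to $0$ as $t\to\infty$), and such that every $\omega$-limit set of $\dot x=f(x)$ is, after translating $p$ to the origin, an $\omega$-limit set of $\dot x=Bx$ with the same dynamics: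 for every $x\in X$ there is $y\in\mathbb{R}^n$ with $$\omega(x)=p+\bigcap_{t\ge 0}\overline{\{e^{sB}y:s\ge t\}},\qquad\text{and}\qquad f(q)=B(q-p)\ \text{ for all } q\in\omega(x).$$ Here $p$ and $B$ do not depend on $x$. 3. For every $x\in X$ there is an integer $k\ge 0$ such that $\omega(x)$ is homeomorphic to the torus $(S^1)^k$ (a single point if $k=0$). -/

import Mathlib

open Set Filter Topology

noncomputable section

/-- `φ` is the forward time evolution of `ẋ = f x` on the state space `X`: the set `X` is forward
invariant and, for every `x ∈ X`, the curve `t ↦ φ t x` is defined for all `t ≥ 0`, starts at `x`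
and solves `ẋ = f x` (one-sided derivative at `t = 0`). Values of `φ` at `t < 0` or outside `X`
play no role. -/
structure IsForwardEvolution {E : Type*} [NormedAddCommGroup E] [NormedSpace ℝ E]
    (f : E → E) (X : Set E) (φ : ℝ → E → E) : Prop where
  forwardInvariant : IsForwardInvariant φ X
  initial : ∀ x ∈ X, φ 0 x = x
  solution : ∀ x ∈ X, IsIntegralCurveOn (fun t => φ t x) (fun _ => f) (Ici 0)

/-- The evolution `φ` does not increase distances between points of the state space `X`. -/
def IsNonexpansiveEvolution {E : Type*} [NormedAddCommGroup E]
    (X : Set E) (φ : ℝ → E → E) : Prop :=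
  ∀ t : ℝ, 0 < t → ∀ x ∈ X, ∀ y ∈ X, ‖φ t x - φ t y‖ ≤ ‖x - y‖

/-- The forward trajectory of `x` is bounded. -/
def HasBoundedTrajectory {E : Type*} [NormedAddCommGroup E] (φ : ℝ → E → E) (x : E) : Prop :=
  Bornology.IsBounded ((fun t => φ t x) '' Ici 0)

/-- The flow `(t, x) ↦ exp (t B) x` of the linear system `ẋ = B x`. -/
def linearFlow {E : Type*} [NormedAddCommGroup E] [NormedSpace ℝ E]
    (B : E →L[ℝ] E) (t : ℝ) (x : E) : E :=
  NormedSpace.exp (t • B) x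

/-- The linear system `ẋ = B x` is conserved: all its trajectories are bounded (in forward time)
and none of them, except the constant trajectory at `0`, converges to `0`. -/
def IsConserved {E : Type*} [NormedAddCommGroup E] [NormedSpace ℝ E] (B : E →L[ℝ] E) : Prop :=
  (∀ x : E, HasBoundedTrajectory (linearFlow B) x) ∧
    ∀ x : E, x ≠ 0 → ¬ Tendsto (fun t => linearFlow B t x) atTop (𝓝 0)

end

/-! ### Integral curves: uniqueness, time shifts, uniform limits. -/

section IntegralCurve

variable {E : Type*} [NormedAddCommGroup E] [NormedSpace ℝ E]

/-! Nonexpansiveness extends the evolution to the closure of `X`, so `X` may be taken closed. One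
bounded trajectory bounds all others. An idempotent ultrafilter `U` of times tending to infinity
makes `φ t x` converge, along `U`, to a point `q` with `φ t q → q` along `U`
(`exists_recurrent_limit`). Distances along two trajectories never increase, so `φ t x` and `φ t q`
merge as `t → ∞` and have the same limit set: only recurrent points matter.

On recurrent points the flow is isometric, since a distance that dropped could not return to its
initial value. Strict convexity makes points of a segment the only ones with the right distances to
its ends, so the flow is affine on segments between recurrent points (`apply_lineMap`). The
Chebyshev centre of a recurrent orbit is an equilibrium `p`. Affinity on the segment from `p` to a
recurrent `q` forces `f q = Df(p) (q - p)`. Restricting `Df(p)` to the span of the vectors `q - p`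
and extending it by zero on a complement gives `B`, all of whose points are recurrent.

Recurrence leaves `B` only imaginary eigenvalues and no Jordan blocks, so in suitable complex
coordinates the flow rotates each coordinate. A `ℤ`-basis of the group generated by the active
frequencies and Kronecker's theorem then identify the limit set with a torus. -/

theorem IsIntegralCurveOn.eqOn_Ici_of_contDiff {f : E → E} (hf : ContDiff ℝ 1 f) {u v : ℝ → E}
    (hu : IsIntegralCurveOn u (fun _ => f) (Ici 0)) (hv : IsIntegralCurveOn v (fun _ => f) (Ici 0))
    (h0 : u 0 = v 0) : EqOn u v (Ici 0) := by
  intro T hT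
  have hT : (0 : ℝ) ≤ T := hT
  have hcu : ContinuousOn u (Icc 0 T) := fun t ht =>
    (hu t ht.1).continuousWithinAt.mono Icc_subset_Ici_self
  have hcv : ContinuousOn v (Icc 0 T) := fun t ht =>
    (hv t ht.1).continuousWithinAt.mono Icc_subset_Ici_self
  obtain ⟨K, hK⟩ := (hf.locallyLipschitz.locallyLipschitzOn
    (s := u '' Icc 0 T ∪ v '' Icc 0 T)).exists_lipschitzOnWith_of_compact
    ((isCompact_Icc.image_of_continuousOn hcu).union (isCompact_Icc.image_of_continuousOn hcv))
  exact ODE_solution_unique_of_mem_Icc_right (v := fun _ => f)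
    (s := fun _ => u '' Icc 0 T ∪ v '' Icc 0 T) (fun _ _ => hK) hcu
    (fun t ht => (hu t ht.1).mono (Ici_subset_Ici.2 ht.1))
    (fun t ht => Or.inl (mem_image_of_mem u (Ico_subset_Icc_self ht))) hcv
    (fun t ht => (hv t ht.1).mono (Ici_subset_Ici.2 ht.1))
    (fun t ht => Or.inr (mem_image_of_mem v (Ico_subset_Icc_self ht))) h0 ⟨hT, le_rfl⟩

theorem IsIntegralCurveOn.comp_const_add {f : E → E} {u : ℝ → E}
    (hu : IsIntegralCurveOn u (fun _ => f) (Ici 0)) {s : ℝ} (hs : 0 ≤ s) :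
    IsIntegralCurveOn (fun t => u (s + t)) (fun _ => f) (Ici 0) := by
  intro t ht
  have ht : (0 : ℝ) ≤ t := ht
  have h1 : HasDerivWithinAt (fun t : ℝ => s + t) 1 (Ici 0) t :=
    ((hasDerivAt_id t).const_add s).hasDerivWithinAt
  have h2 := (hu (s + t) (add_nonneg hs ht)).scomp t h1
    (fun r hr => add_nonneg hs hr)
  simpa [Function.comp_def] using h2

/-- A uniform limit of integral curves of a continuous vector field is an integral curve. -/
theorem isIntegralCurveOn_Ici_of_tendsto [FiniteDimensional ℝ E] {f : E → E} (hf : Continuous f)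
    {u : ℕ → ℝ → E} {v : ℝ → E}
    (hu : ∀ n, IsIntegralCurveOn (u n) (fun _ => f) (Ici 0))
    (huv : TendstoUniformlyOn u v atTop (Ici 0)) :
    IsIntegralCurveOn v (fun _ => f) (Ici 0) := by
  have hcu : ∀ n, ContinuousOn (u n) (Ici 0) := fun n t ht => (hu n t ht).continuousWithinAt
  have hcv : ContinuousOn v (Ici 0) := huv.continuousOn (Eventually.of_forall hcu).frequently
  have hint : ∀ n, ∀ t ∈ Ici (0 : ℝ), ∫ s in (0 : ℝ)..t, f (u n s) = u n t - u n 0 := by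
    intro n t ht
    have ht : (0 : ℝ) ≤ t := ht
    refine intervalIntegral.integral_eq_sub_of_hasDerivAt_of_le ht
      ((hcu n).mono Icc_subset_Ici_self)
      (fun s hs => (hu n s hs.1.le).hasDerivAt (Ici_mem_nhds hs.1)) ?_
    refine ContinuousOn.intervalIntegrable ?_
    rw [uIcc_of_le ht]
    exact hf.comp_continuousOn ((hcu n).mono Icc_subset_Ici_self)
  have hlim : ∀ t ∈ Ici (0 : ℝ), ∫ s in (0 : ℝ)..t, f (v s) = v t - v 0 := by
    intro t ht
    have ht' : (0 : ℝ) ≤ t := ht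
    have hcpt : IsCompact (v '' Icc 0 t) :=
      isCompact_Icc.image_of_continuousOn (hcv.mono Icc_subset_Ici_self)
    -- The dominating constant: for large `n` the curves `u n` stay within distance 1 of the compact
    -- arc of `v`.
    obtain ⟨C, hC⟩ := (hcpt.cthickening (r := 1)).exists_bound_of_continuousOn hf.continuousOn
    have hev : ∀ᶠ n in atTop, ∀ s ∈ Ici (0 : ℝ), dist (v s) (u n s) < 1 :=
      Metric.tendstoUniformlyOn_iff.1 huv 1 one_pos
    have hlim := intervalIntegral.tendsto_integral_filter_of_dominated_convergence
      (μ := MeasureTheory.volume) (a := 0) (b := t) (l := atTop)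
      (F := fun n s => f (u n s)) (f := fun s => f (v s)) (fun _ => C) ?_ ?_ ?_ ?_
    · have h2 : Tendsto (fun n => u n t - u n 0) atTop (𝓝 (v t - v 0)) :=
        (huv.tendsto_at ht).sub (huv.tendsto_at (mem_Ici.2 le_rfl))
      refine tendsto_nhds_unique hlim (h2.congr fun n => (hint n t ht).symm)
    · refine Eventually.of_forall fun n => ?_
      rw [uIoc_of_le ht']
      exact (hf.comp_continuousOn ((hcu n).mono fun s hs => hs.1.le)).aestronglyMeasurable
        measurableSet_Ioc
    · filter_upwards [hev] with n hn
      refine Eventually.of_forall fun s hs => hC _ ?_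
      rw [uIoc_of_le ht'] at hs
      refine Metric.mem_cthickening_of_dist_le _ (v s) _ _
        (mem_image_of_mem v (Ioc_subset_Icc_self hs)) ?_
      rw [dist_comm]
      exact (hn s hs.1.le).le
    · exact intervalIntegrable_const
    · refine Eventually.of_forall fun s hs => ?_
      rw [uIoc_of_le ht'] at hs
      exact (hf.tendsto _).comp (huv.tendsto_at hs.1.le)
  -- Freezing `v` at negative times makes the integrand continuous on all of `ℝ`, so the fundamental
  -- theorem applies at 0 as well.
  have hext : Continuous fun s => f (v (max s 0)) :=
    hf.comp (hcv.comp_continuous (by fun_prop) fun s => le_max_right s 0)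
  intro t ht
  have hd : HasDerivAt (fun r => v 0 + ∫ s in (0 : ℝ)..r, f (v (max s 0))) (f (v (max t 0))) t :=
    (hext.integral_hasStrictDerivAt 0 t).hasDerivAt.const_add _
  have hcongr : ∀ r ∈ Ici (0 : ℝ), v r = v 0 + ∫ s in (0 : ℝ)..r, f (v (max s 0)) := by
    intro r hr
    have hr' : (0 : ℝ) ≤ r := hr
    rw [intervalIntegral.integral_congr (g := fun s => f (v s)), hlim r hr]
    · abel
    · intro s hs
      rw [uIcc_of_le hr'] at hs
      simp [max_eq_left hs.1]
  have := hd.hasDerivWithinAt (s := Ici 0)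
  rw [max_eq_left ht] at this
  exact this.congr hcongr (hcongr t ht)

end IntegralCurve

/-! ### Semigroup law and extension to the closure. -/

section Evolution

variable {E : Type*} [NormedAddCommGroup E] [NormedSpace ℝ E]
  {f : E → E} {X : Set E} {φ : ℝ → E → E}

theorem IsForwardEvolution.add (hf : ContDiff ℝ 1 f) (hφ : IsForwardEvolution f X φ) {s t : ℝ}
    (hs : 0 ≤ s) (ht : 0 ≤ t) {x : E} (hx : x ∈ X) : φ (s + t) x = φ s (φ t x) := by
  have hmem : φ t x ∈ X := hφ.forwardInvariant ht hx
  have := ((hφ.solution x hx).comp_const_add ht).eqOn_Ici_of_contDiff hf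
    (hφ.solution _ hmem) (by simp [hφ.initial _ hmem]) hs
  simpa [add_comm] using this

theorem IsNonexpansiveEvolution.norm_sub_le (hφ : IsForwardEvolution f X φ)
    (hne : IsNonexpansiveEvolution X φ) {t : ℝ} (ht : 0 ≤ t) {x y : E} (hx : x ∈ X) (hy : y ∈ X) :
    ‖φ t x - φ t y‖ ≤ ‖x - y‖ := by
  rcases ht.eq_or_lt with rfl | ht
  · rw [hφ.initial x hx, hφ.initial y hy]
  · exact hne t ht x hx y hy

/-- A nonexpansive evolution extends to the closure of its state space. -/
theorem IsForwardEvolution.exists_extension_closure [FiniteDimensional ℝ E]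
    (hf : Continuous f) (hφ : IsForwardEvolution f X φ) (hne : IsNonexpansiveEvolution X φ) :
    ∃ ψ : ℝ → E → E, IsForwardEvolution f (closure X) ψ ∧ IsNonexpansiveEvolution (closure X) ψ ∧
      ∀ t, 0 ≤ t → ∀ x ∈ X, ψ t x = φ t x := by
  have : CompleteSpace E := FiniteDimensional.complete ℝ E
  have hlip : ∀ t, 0 ≤ t → LipschitzOnWith 1 (φ t) X := fun t ht =>
    LipschitzOnWith.of_dist_le_mul fun x hx y hy => by
      simpa [dist_eq_norm] using hne.norm_sub_le hφ ht hx hy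
  have hex : ∀ t, 0 ≤ t → ∀ x ∈ closure X, ∃ y, Tendsto (φ t) (𝓝[X] x) (𝓝 y) := by
    intro t ht x hx
    have : (𝓝[X] x).NeBot := mem_closure_iff_nhdsWithin_neBot.1 hx
    have hc : Cauchy (map (φ t) (𝓝[X] x)) := by
      refine Cauchy.map_of_le (cauchy_nhds.mono inf_le_left) (hlip t ht).uniformContinuousOn
        inf_le_right
    exact CompleteSpace.complete hc
  let ψ : ℝ → E → E := fun t => extendFrom X (φ t)
  have hlim : ∀ t, 0 ≤ t → ∀ x ∈ closure X, Tendsto (φ t) (𝓝[X] x) (𝓝 (ψ t x)) :=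
    fun t ht x hx => tendsto_extendFrom (hex t ht x hx)
  have hEq : ∀ t, 0 ≤ t → ∀ x ∈ X, ψ t x = φ t x := fun t ht x hx =>
    extendFrom_extends (hlip t ht).continuousOn x hx
  have hseq : ∀ x ∈ closure X, ∃ a : ℕ → E, (∀ n, a n ∈ X) ∧ Tendsto a atTop (𝓝 x) :=
    fun x hx => mem_closure_iff_seq_limit.1 hx
  have hlimseq : ∀ t, 0 ≤ t → ∀ x ∈ closure X, ∀ a : ℕ → E, (∀ n, a n ∈ X) →
      Tendsto a atTop (𝓝 x) → Tendsto (fun n => φ t (a n)) atTop (𝓝 (ψ t x)) :=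
    fun t ht x hx a ha hax => (hlim t ht x hx).comp
      (tendsto_nhdsWithin_iff.2 ⟨hax, Eventually.of_forall ha⟩)
  have hnonexp : ∀ t, 0 ≤ t → ∀ x ∈ closure X, ∀ y ∈ closure X, ‖ψ t x - ψ t y‖ ≤ ‖x - y‖ := by
    intro t ht x hx y hy
    obtain ⟨a, ha, hax⟩ := hseq x hx
    obtain ⟨b, hb, hby⟩ := hseq y hy
    exact le_of_tendsto_of_tendsto'
      ((hlimseq t ht x hx a ha hax).sub (hlimseq t ht y hy b hb hby)).norm (hax.sub hby).norm
      fun n => hne.norm_sub_le hφ ht (ha n) (hb n)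
  refine ⟨ψ, ⟨?_, ?_, ?_⟩, fun t ht => hnonexp t ht.le, hEq⟩
  · intro t ht x hx
    obtain ⟨a, ha, hax⟩ := hseq x hx
    exact mem_closure_of_tendsto (hlimseq t ht x hx a ha hax)
      (Eventually.of_forall fun n => hφ.forwardInvariant ht (ha n))
  · intro x hx
    obtain ⟨a, ha, hax⟩ := hseq x hx
    refine tendsto_nhds_unique (hlimseq 0 le_rfl x hx a ha hax) (hax.congr fun n => ?_)
    rw [hφ.initial _ (ha n)]
  · intro x hx
    obtain ⟨a, ha, hax⟩ := hseq x hx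
    refine isIntegralCurveOn_Ici_of_tendsto hf (u := fun n t => φ t (a n))
      (fun n => hφ.solution _ (ha n)) ?_
    -- Uniformity in `t` is free: the distance at time `t` is at most the initial one.
    rw [Metric.tendstoUniformlyOn_iff]
    intro ε hε
    filter_upwards [Metric.tendsto_nhds.1 hax ε hε] with n hn t ht
    rw [← hEq t ht _ (ha n), dist_eq_norm]
    refine (hnonexp t ht x hx (a n) (subset_closure (ha n))).trans_lt ?_
    rwa [← dist_eq_norm, dist_comm]

end Evolution

/-! ### Idempotent ultrafilters of times. -/

section Ultrafilter

attribute [local instance] Ultrafilter.addSemigroup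

/-- The Ellis–Numakura lemma: the ultrafilters finer than `atTop` form a nonempty compact
subsemigroup of the ultrafilters on `ℝ`, so it contains an idempotent. -/
theorem exists_ultrafilter_le_atTop_add_idempotent :
    ∃ U : Ultrafilter ℝ, (U : Filter ℝ) ≤ atTop ∧
      ∀ p : ℝ → Prop, (∀ᶠ t in U, p t) ↔ ∀ᶠ s in U, ∀ᶠ t in U, p (s + t) := by
  have hcpt : IsCompact {U : Ultrafilter ℝ | (U : Filter ℝ) ≤ atTop} := by
    have : {U : Ultrafilter ℝ | (U : Filter ℝ) ≤ atTop} = ⋂ a : ℝ, {U | Ici a ∈ U} := by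
      ext U
      simp only [Set.mem_iInter, Set.mem_ofPred_eq]
      exact ⟨fun h a => h (Ici_mem_atTop a), fun h => le_iInf fun a => le_principal_iff.2 (h a)⟩
    rw [this]
    exact (isClosed_iInter fun a => ultrafilter_isClosed_basic _).isCompact
  have hadd : ∀ U ∈ {U : Ultrafilter ℝ | (U : Filter ℝ) ≤ atTop},
      ∀ V ∈ {U : Ultrafilter ℝ | (U : Filter ℝ) ≤ atTop},
      U + V ∈ {U : Ultrafilter ℝ | (U : Filter ℝ) ≤ atTop} := by
    intro U hU V hV s hs
    obtain ⟨a, ha⟩ := mem_atTop_sets.1 hs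
    change ∀ᶠ t in ((U + V : Ultrafilter ℝ) : Filter ℝ), t ∈ s
    rw [Ultrafilter.eventually_add]
    filter_upwards [hU (Ici_mem_atTop 0)] with x hx
    filter_upwards [hV (Ici_mem_atTop a)] with y hy
    exact ha _ (le_add_of_nonneg_of_le hx hy)
  obtain ⟨U, hU, hidem⟩ := exists_idempotent_in_compact_add_subsemigroup
    Ultrafilter.continuous_add_left {U : Ultrafilter ℝ | (U : Filter ℝ) ≤ atTop}
    ⟨Ultrafilter.of atTop, Ultrafilter.of_le atTop⟩ hcpt hadd
  refine ⟨U, hU, fun p => ?_⟩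
  rw [← Ultrafilter.eventually_add, hidem]

end Ultrafilter

/-! ### Strict convexity: segments and Chebyshev centres. -/

section StrictConvex

variable {E : Type*} [NormedAddCommGroup E] [NormedSpace ℝ E] [StrictConvexSpace ℝ E]

theorem eq_lineMap_of_dist_le_mul_of_dist_le_mul {x y z : E} {r : ℝ}
    (h1 : dist x y ≤ r * dist x z) (h2 : dist y z ≤ (1 - r) * dist x z) :
    y = AffineMap.lineMap x z r := by
  have := dist_triangle x y z
  exact eq_lineMap_of_dist_eq_mul_of_dist_eq_mul (by linarith) (by linarith)

/-- Existence and uniqueness of the Chebyshev centre, relative to a closed convex set, of a compact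
set: any point that is not farther from `K` than the centre equals the centre. -/
theorem exists_chebyshev_center [FiniteDimensional ℝ E] {K X : Set E} (hK : IsCompact K)
    (hKne : K.Nonempty) (hX : IsClosed X) (hXc : Convex ℝ X) (hXne : X.Nonempty) :
    ∃ p ∈ X, ∀ y ∈ X, (∀ C, (∀ z ∈ K, dist z p ≤ C) → ∀ z ∈ K, dist z y ≤ C) → y = p := by
  have : ProperSpace E := FiniteDimensional.proper_real E
  let r : E → ℝ := fun y => sSup ((fun z => dist z y) '' K)
  have hr : Continuous r :=
    hK.continuous_sSup (f := fun y z => dist z y)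
      (by simp only [Function.HasUncurry.uncurry, id]; fun_prop)
  have hle : ∀ y, ∀ z ∈ K, dist z y ≤ r y := fun y z hz =>
    le_csSup (hK.image (by fun_prop)).bddAbove (mem_image_of_mem _ hz)
  have hatt : ∀ y, ∃ z ∈ K, r y = dist z y := fun y =>
    hK.exists_sSup_image_eq hKne (f := fun z => dist z y) (by fun_prop)
  obtain ⟨x₀, hx₀⟩ := hXne
  obtain ⟨z₀, hz₀⟩ := hKne
  obtain ⟨p, hp, hmin⟩ := hr.continuousOn.exists_isMinOn' hX hx₀ (by
    refine Eventually.filter_mono inf_le_left ?_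
    filter_upwards [(tendsto_dist_left_cocompact_atTop z₀).eventually_ge_atTop (r x₀)] with y hy
    exact hy.trans (hle y z₀ hz₀))
  refine ⟨p, hp, fun y hy h => ?_⟩
  by_contra hne
  -- A second minimizer `y ≠ p` is impossible: by strict convexity the farthest point of `K` from
  -- the midpoint would be strictly closer than the minimal radius `r p`.
  obtain ⟨z, hz, hrz⟩ := hatt ((1 / 2 : ℝ) • y + (1 / 2 : ℝ) • p)
  have hm := isMinOn_iff.1 hmin _ (hXc hy hp (by norm_num : (0 : ℝ) ≤ 1 / 2)
    (by norm_num : (0 : ℝ) ≤ 1 / 2) (by norm_num))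
  have := combo_mem_ball_of_ne (x := y) (y := p) (z := z) (r := r p) (a := 1 / 2) (b := 1 / 2)
    (by rw [Metric.mem_closedBall, dist_comm]; exact h _ (hle p) z hz)
    (by rw [Metric.mem_closedBall, dist_comm]; exact hle p z hz) hne (by norm_num) (by norm_num)
    (by norm_num)
  rw [Metric.mem_ball, dist_comm] at this
  linarith

end StrictConvex

/-- `φ` is a semigroup, indexed by nonnegative times, of nonexpansive self-maps of `X`. -/
structure IsNonexpansiveSemigroup {E : Type*} [PseudoMetricSpace E] (X : Set E) (φ : ℝ → E → E) :
    Prop where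
  mapsTo : ∀ {t}, 0 ≤ t → MapsTo (φ t) X X
  zero : ∀ {x}, x ∈ X → φ 0 x = x
  add : ∀ {s t x}, 0 ≤ s → 0 ≤ t → x ∈ X → φ (s + t) x = φ s (φ t x)
  dist_le : ∀ {t x y}, 0 ≤ t → x ∈ X → y ∈ X → dist (φ t x) (φ t y) ≤ dist x y

/-- The points of `X` that are recurrent for `φ` along the filter `U` of times. -/
def recurrentSet {E : Type*} [TopologicalSpace E] (X : Set E) (φ : ℝ → E → E) (U : Filter ℝ) :
    Set E :=
  {q | q ∈ X ∧ Tendsto (fun t => φ t q) U (𝓝 q)}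

/-! ### Recurrence in nonexpansive semigroups. -/

namespace IsNonexpansiveSemigroup

section Metric

variable {E : Type*} [MetricSpace E] {X : Set E} {φ : ℝ → E → E} {U : Filter ℝ}

theorem comm (h : IsNonexpansiveSemigroup X φ) {s t : ℝ} {x : E} (hs : 0 ≤ s) (ht : 0 ≤ t)
    (hx : x ∈ X) : φ s (φ t x) = φ t (φ s x) := by
  rw [← h.add hs ht hx, ← h.add ht hs hx, add_comm]

theorem tendsto_apply (h : IsNonexpansiveSemigroup X φ) {ι : Type*} {l : Filter ι} {u : ι → E}
    {x : E} {t : ℝ} (ht : 0 ≤ t) (hu : ∀ᶠ i in l, u i ∈ X) (hx : x ∈ X)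
    (hlim : Tendsto u l (𝓝 x)) : Tendsto (fun i => φ t (u i)) l (𝓝 (φ t x)) := by
  rw [tendsto_iff_dist_tendsto_zero] at hlim ⊢
  exact squeeze_zero' (Eventually.of_forall fun _ => dist_nonneg)
    (hu.mono fun i hi => h.dist_le ht hi hx) hlim

theorem dist_le_dist_of_le (h : IsNonexpansiveSemigroup X φ) {s t : ℝ} {x y : E} (hs : 0 ≤ s)
    (hst : s ≤ t) (hx : x ∈ X) (hy : y ∈ X) : dist (φ t x) (φ t y) ≤ dist (φ s x) (φ s y) := by
  have h1 : t = (t - s) + s := by ring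
  rw [h1, h.add (sub_nonneg.2 hst) hs hx, h.add (sub_nonneg.2 hst) hs hy]
  exact h.dist_le (sub_nonneg.2 hst) (h.mapsTo hs hx) (h.mapsTo hs hy)

theorem apply_mem_recurrentSet (h : IsNonexpansiveSemigroup X φ) (hU : U ≤ atTop) {q : E}
    (hq : q ∈ recurrentSet X φ U) {t : ℝ} (ht : 0 ≤ t) : φ t q ∈ recurrentSet X φ U := by
  have hnn : ∀ᶠ s in U, (0 : ℝ) ≤ s := hU (eventually_ge_atTop 0)
  refine ⟨h.mapsTo ht hq.1, (h.tendsto_apply ht (hnn.mono fun s hs => h.mapsTo hs hq.1) hq.1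
    hq.2).congr' ?_⟩
  filter_upwards [hnn] with s hs
  exact h.comm ht hs hq.1

theorem isClosed_recurrentSet (h : IsNonexpansiveSemigroup X φ) (hU : U ≤ atTop)
    (hX : IsClosed X) : IsClosed (recurrentSet X φ U) := by
  have hnn : ∀ᶠ s in U, (0 : ℝ) ≤ s := hU (eventually_ge_atTop 0)
  refine isClosed_of_closure_subset fun q hq => ?_
  have hqX : q ∈ X := hX.closure_subset_iff.2 (fun _ h => h.1) hq
  refine ⟨hqX, Metric.tendsto_nhds.2 fun ε hε => ?_⟩
  obtain ⟨b, hb, hqb⟩ := Metric.mem_closure_iff.1 hq (ε / 3) (by positivity)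
  filter_upwards [hnn, Metric.tendsto_nhds.1 hb.2 (ε / 3) (by positivity)] with t ht hbt
  have h1 := h.dist_le ht hqX hb.1
  have h2 := dist_triangle4 (φ t q) (φ t b) b q
  rw [dist_comm b q] at h2
  linarith

/-- The distance along the two trajectories is nonincreasing, yet tends back to `dist q r` along
`U`, so it never drops. -/
theorem dist_eq_of_mem_recurrentSet (h : IsNonexpansiveSemigroup X φ) (hU : U ≤ atTop) [U.NeBot]
    {q r : E} (hq : q ∈ recurrentSet X φ U) (hr : r ∈ recurrentSet X φ U) {t : ℝ} (ht : 0 ≤ t) :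
    dist (φ t q) (φ t r) = dist q r := by
  refine (h.dist_le ht hq.1 hr.1).antisymm ?_
  refine le_of_tendsto (hq.2.dist hr.2) ?_
  filter_upwards [hU (eventually_ge_atTop t)] with s hs
  exact h.dist_le_dist_of_le ht hs hq.1 hr.1

/-- Along an idempotent ultrafilter of times, a nonexpansive semigroup with relatively compact
trajectories converges to a retraction onto the recurrent points. -/
theorem exists_recurrent_limit [ProperSpace E] (h : IsNonexpansiveSemigroup X φ) (hX : IsClosed X)
    (hb : ∀ x ∈ X, Bornology.IsBounded ((fun t => φ t x) '' Ici 0)) {U : Ultrafilter ℝ}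
    (hU : (U : Filter ℝ) ≤ atTop)
    (hidem : ∀ p : ℝ → Prop, (∀ᶠ t in U, p t) ↔ ∀ᶠ s in U, ∀ᶠ t in U, p (s + t)) {x : E}
    (hx : x ∈ X) :
    ∃ q ∈ recurrentSet X φ U, Tendsto (fun t => φ t x) U (𝓝 q) := by
  have hnn : ∀ᶠ s in U, (0 : ℝ) ≤ s := hU (eventually_ge_atTop 0)
  have hex : ∃ q ∈ X, Tendsto (fun t => φ t x) U (𝓝 q) := by
    obtain ⟨q, -, hq⟩ := (hb x hx).isCompact_closure.ultrafilter_le_nhds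
      (U.map fun t => φ t x) (le_principal_iff.2 (by
        rw [Ultrafilter.mem_coe, Ultrafilter.mem_map]
        filter_upwards [hnn] with t ht using subset_closure (mem_image_of_mem _ ht)))
    exact ⟨q, hX.mem_of_tendsto hq (hnn.mono fun t ht => h.mapsTo ht hx), hq⟩
  obtain ⟨q, hqX, hq⟩ := hex
  refine ⟨q, ⟨hqX, Metric.tendsto_nhds.2 fun ε hε => ?_⟩, hq⟩
  -- Idempotence turns the limit over `t` into an iterated one: for most `s`, `φ (s + t) x` is near
  -- `q` for most `t`. Letting `t` run along `U` inside `φ s` puts `φ s q` near `q`.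
  have h1 := (hidem _).1 (Metric.tendsto_nhds.1 hq (ε / 2) (half_pos hε))
  filter_upwards [h1, hnn] with s hs hs0
  have h2 : Tendsto (fun t => dist (φ s (φ t x)) q) U (𝓝 (dist (φ s q) q)) :=
    (h.tendsto_apply hs0 (hnn.mono fun t ht => h.mapsTo ht hx) hqX hq).dist tendsto_const_nhds
  refine (le_of_tendsto h2 ?_).trans_lt (half_lt_self hε)
  filter_upwards [hs, hnn] with t ht ht0
  rw [← h.add hs0 ht0 hx]
  exact ht.le

/-- Both trajectories tend to `q` along `U`, so their distance is small at some time; being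
nonincreasing, it stays small. -/
theorem tendsto_dist_atTop (h : IsNonexpansiveSemigroup X φ) (hU : U ≤ atTop) [U.NeBot]
    {x q : E} (hx : x ∈ X) (hq : q ∈ recurrentSet X φ U) (hlim : Tendsto (fun t => φ t x) U (𝓝 q)) :
    Tendsto (fun t => dist (φ t x) (φ t q)) atTop (𝓝 0) := by
  rw [Metric.tendsto_nhds]
  intro ε hε
  have h0 : Tendsto (fun t => dist (φ t x) (φ t q)) U (𝓝 0) := by simpa using hlim.dist hq.2
  obtain ⟨s, hs, hs0⟩ := ((Metric.tendsto_nhds.1 h0 ε hε).and (hU (eventually_ge_atTop 0))).exists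
  filter_upwards [eventually_ge_atTop s] with t ht
  rw [Real.dist_0_eq_abs, abs_of_nonneg dist_nonneg] at hs ⊢
  exact (h.dist_le_dist_of_le hs0 ht hx hq.1).trans_lt hs

theorem omegaLimit_subset_recurrentSet (h : IsNonexpansiveSemigroup X φ) (hU : U ≤ atTop)
    (hX : IsClosed X) {q : E} (hq : q ∈ recurrentSet X φ U) :
    omegaLimit atTop φ {q} ⊆ recurrentSet X φ U := by
  refine (omegaLimit_subset_closure_image2 _ _ _ (Ici_mem_atTop (0 : ℝ))).trans ?_
  refine (h.isClosed_recurrentSet hU hX).closure_subset_iff.2 ?_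
  rintro _ ⟨t, ht, _, rfl, rfl⟩
  exact h.apply_mem_recurrentSet hU hq ht

end Metric

end IsNonexpansiveSemigroup

theorem mapClusterPt_of_tendsto_dist {E ι : Type*} [PseudoMetricSpace E] {l : Filter ι}
    {u v : ι → E} (h : Tendsto (fun i => dist (u i) (v i)) l (𝓝 0)) {y : E}
    (hy : MapClusterPt y l u) : MapClusterPt y l v := by
  rw [mapClusterPt_iff_frequently] at hy ⊢
  intro s hs
  obtain ⟨ε, hε, hball⟩ := Metric.mem_nhds_iff.1 hs
  refine ((hy _ (Metric.ball_mem_nhds y (half_pos hε))).and_eventually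
    (Metric.tendsto_nhds.1 h _ (half_pos hε))).mono ?_
  rintro i ⟨h1, h2⟩
  rw [Real.dist_0_eq_abs, abs_of_nonneg dist_nonneg] at h2
  refine hball ?_
  rw [Metric.mem_ball] at h1 ⊢
  have := dist_triangle_left (v i) y (u i)
  linarith

theorem omegaLimit_eq_of_tendsto_dist {E : Type*} [PseudoMetricSpace E] {φ ψ : ℝ → E → E}
    {x y : E} (h : Tendsto (fun t => dist (φ t x) (ψ t y)) atTop (𝓝 0)) :
    omegaLimit atTop φ {x} = omegaLimit atTop ψ {y} := by
  ext z
  simp only [mem_omegaLimit_singleton_iff_mapClusterPt]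
  exact ⟨mapClusterPt_of_tendsto_dist h,
    mapClusterPt_of_tendsto_dist (by simpa only [dist_comm] using h)⟩

/-! ### Affinity on recurrent segments, and a fixed point. -/

namespace IsNonexpansiveSemigroup

variable {E : Type*} [NormedAddCommGroup E] [NormedSpace ℝ E] [StrictConvexSpace ℝ E]
  {X : Set E} {φ : ℝ → E → E}

/-- The image point is no farther from the images of the ends than before, while the ends keep their
distance; strict convexity leaves only one such point. -/
theorem apply_lineMap (h : IsNonexpansiveSemigroup X φ) (hXc : Convex ℝ X) {U : Filter ℝ}
    (hU : U ≤ atTop) [U.NeBot] {q r : E} (hq : q ∈ recurrentSet X φ U)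
    (hr : r ∈ recurrentSet X φ U) {t c : ℝ} (ht : 0 ≤ t) (hc : c ∈ Icc (0 : ℝ) 1) :
    φ t (AffineMap.lineMap q r c) = AffineMap.lineMap (φ t q) (φ t r) c := by
  have hm : AffineMap.lineMap q r c ∈ X := hXc.lineMap_mem hq.1 hr.1 hc
  have heq := h.dist_eq_of_mem_recurrentSet hU hq hr ht
  refine eq_lineMap_of_dist_le_mul_of_dist_le_mul ?_ ?_
  · refine (h.dist_le ht hq.1 hm).trans_eq ?_
    rw [dist_left_lineMap, heq, Real.norm_of_nonneg hc.1]
  · refine (h.dist_le ht hm hr.1).trans_eq ?_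
    rw [dist_lineMap_right, heq, Real.norm_of_nonneg (sub_nonneg.2 hc.2)]

/-- The fixed point is the Chebyshev centre `p` of the orbit closure of `q`. By recurrence each
orbit point is a limit of images under `φ t` of orbit points, so `φ t p` is as good a centre as `p`,
and uniqueness applies. -/
theorem exists_fixedPoint [FiniteDimensional ℝ E] (h : IsNonexpansiveSemigroup X φ)
    (hX : IsClosed X) (hXc : Convex ℝ X) {U : Filter ℝ} (hU : U ≤ atTop) [U.NeBot] {q : E}
    (hq : q ∈ recurrentSet X φ U) (hb : Bornology.IsBounded ((fun t => φ t q) '' Ici 0)) :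
    ∃ p ∈ X, ∀ t, 0 ≤ t → φ t p = p := by
  have : ProperSpace E := FiniteDimensional.proper_real E
  obtain ⟨p, hp, huniq⟩ := exists_chebyshev_center hb.isCompact_closure
    (nonempty_Ici.image _).closure hX hXc ⟨q, hq.1⟩
  refine ⟨p, hp, fun t ht => huniq _ (h.mapsTo ht hp) fun C hC z hz => ?_⟩
  refine closure_minimal (s := (fun t => φ t q) '' Ici 0) (t := {z | dist z (φ t p) ≤ C}) ?_
    (isClosed_le (by fun_prop) (by fun_prop)) hz
  rintro _ ⟨s, hs, rfl⟩
  have hs : (0 : ℝ) ≤ s := hs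
  refine le_of_tendsto ((h.apply_mem_recurrentSet hU hq hs).2.dist tendsto_const_nhds) ?_
  filter_upwards [hU (eventually_ge_atTop t)] with m hm
  have hm' : 0 ≤ m - t := sub_nonneg.2 hm
  have h1 : φ m (φ s q) = φ t (φ (m - t + s) q) := by
    rw [← h.add (ht.trans hm) hs hq.1, ← h.add ht (add_nonneg hm' hs) hq.1]
    congr 1
    ring
  rw [h1]
  exact (h.dist_le ht (h.mapsTo (add_nonneg hm' hs) hq.1) hp).trans
    (hC _ (subset_closure (mem_image_of_mem _ (add_nonneg hm' hs))))

end IsNonexpansiveSemigroup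

/-! ### Linear flows and their recurrent vectors. -/

section LinearFlow

variable {E : Type*} [NormedAddCommGroup E] [NormedSpace ℝ E]

theorem linearFlow_zero_right (B : E →L[ℝ] E) (t : ℝ) : linearFlow B t 0 = 0 := by
  simp [linearFlow]

theorem linearFlow_add_right (B : E →L[ℝ] E) (t : ℝ) (x y : E) :
    linearFlow B t (x + y) = linearFlow B t x + linearFlow B t y := by
  simp [linearFlow]

theorem linearFlow_smul_right (B : E →L[ℝ] E) (t c : ℝ) (x : E) :
    linearFlow B t (c • x) = c • linearFlow B t x := by
  simp [linearFlow]

theorem linearFlow_zero_left (B : E →L[ℝ] E) (x : E) : linearFlow B 0 x = x := by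
  simp [linearFlow]

theorem hasDerivAt_linearFlow [CompleteSpace E] (B : E →L[ℝ] E) (x : E) (t : ℝ) :
    HasDerivAt (fun s => linearFlow B s x) (B (linearFlow B t x)) t := by
  have h := (hasDerivAt_exp_smul_const' B t).clm_apply (hasDerivAt_const t x)
  simpa [linearFlow] using h

theorem IsIntegralCurveOn.eqOn_linearFlow [CompleteSpace E] {B : E →L[ℝ] E} {u : ℝ → E}
    (hu : IsIntegralCurveOn u (fun _ => B) (Ici 0)) :
    EqOn u (fun t => linearFlow B t (u 0)) (Ici 0) :=
  hu.eqOn_Ici_of_contDiff B.contDiff (fun t _ => (hasDerivAt_linearFlow B _ t).hasDerivWithinAt)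
    (linearFlow_zero_left B _).symm

theorem hasBoundedTrajectory_iff {E : Type*} [NormedAddCommGroup E] {φ : ℝ → E → E} {x : E} :
    HasBoundedTrajectory φ x ↔ ∃ C, ∀ t, 0 ≤ t → ‖φ t x‖ ≤ C := by
  simp [HasBoundedTrajectory, isBounded_iff_forall_norm_le]

/-- The points with bounded trajectory that are recurrent along `U`. -/
def linearFlowRecurrentSubmodule (B : E →L[ℝ] E) (U : Filter ℝ) : Submodule ℝ E where
  carrier := {y | HasBoundedTrajectory (linearFlow B) y ∧
    Tendsto (fun t => linearFlow B t y) U (𝓝 y)}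
  zero_mem' := by
    simp [hasBoundedTrajectory_iff, linearFlow_zero_right, tendsto_const_nhds]
    exact ⟨0, fun _ _ => le_rfl⟩
  add_mem' := by
    rintro x y ⟨hx, hx'⟩ ⟨hy, hy'⟩
    refine ⟨?_, by simpa only [linearFlow_add_right] using hx'.add hy'⟩
    rw [hasBoundedTrajectory_iff] at hx hy ⊢
    obtain ⟨C, hC⟩ := hx
    obtain ⟨D, hD⟩ := hy
    refine ⟨C + D, fun t ht => ?_⟩
    rw [linearFlow_add_right]
    exact norm_add_le_of_le (hC t ht) (hD t ht)
  smul_mem' := by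
    rintro c x ⟨hx, hx'⟩
    refine ⟨?_, by simpa only [linearFlow_smul_right] using hx'.const_smul c⟩
    rw [hasBoundedTrajectory_iff] at hx ⊢
    obtain ⟨C, hC⟩ := hx
    refine ⟨‖c‖ * C, fun t ht => ?_⟩
    rw [linearFlow_smul_right, norm_smul]
    exact mul_le_mul_of_nonneg_left (hC t ht) (norm_nonneg c)

theorem isConserved_of_recurrent {B : E →L[ℝ] E} {U : Filter ℝ} [U.NeBot] (hU : U ≤ atTop)
    (h : linearFlowRecurrentSubmodule B U = ⊤) : IsConserved B := by
  have h' : ∀ y, y ∈ linearFlowRecurrentSubmodule B U := fun y => h ▸ Submodule.mem_top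
  exact ⟨fun y => (h' y).1, fun y hy hlim => hy (tendsto_nhds_unique (h' y).2 (hlim.mono_left hU))⟩

end LinearFlow

/-! ### The linear model on the recurrent set. -/

section Evolution

variable {E : Type*} [NormedAddCommGroup E] [NormedSpace ℝ E]
  {f : E → E} {X : Set E} {φ : ℝ → E → E}

theorem IsForwardEvolution.isNonexpansiveSemigroup (hf : ContDiff ℝ 1 f)
    (hφ : IsForwardEvolution f X φ) (hne : IsNonexpansiveEvolution X φ) :
    IsNonexpansiveSemigroup X φ where
  mapsTo ht := hφ.forwardInvariant ht
  zero hx := hφ.initial _ hx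
  add hs ht hx := hφ.add hf hs ht hx
  dist_le ht hx hy := by simpa only [dist_eq_norm] using hne.norm_sub_le hφ ht hx hy

theorem IsForwardEvolution.hasBoundedTrajectory (hφ : IsForwardEvolution f X φ)
    (hne : IsNonexpansiveEvolution X φ) {x y : E} (hx : x ∈ X) (hy : y ∈ X)
    (h : HasBoundedTrajectory φ x) : HasBoundedTrajectory φ y := by
  rw [hasBoundedTrajectory_iff] at h ⊢
  obtain ⟨C, hC⟩ := h
  refine ⟨C + ‖y - x‖, fun t ht => ?_⟩
  have h1 := hne.norm_sub_le hφ ht hy hx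
  have h2 := norm_le_norm_add_norm_sub' (φ t y) (φ t x)
  linarith [hC t ht]

theorem IsForwardEvolution.eq_zero_of_fixed (hφ : IsForwardEvolution f X φ) {p : E} (hp : p ∈ X)
    (hfix : ∀ t, 0 ≤ t → φ t p = p) : f p = 0 := by
  have h1 := hφ.solution p hp 0 (mem_Ici.2 le_rfl)
  have h2 : HasDerivWithinAt (fun t => φ t p) 0 (Ici 0) 0 :=
    (hasDerivWithinAt_const (0 : ℝ) (Ici 0) p).congr (fun t ht => hfix t ht) (hfix 0 le_rfl)
  simpa [hφ.initial p hp] using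
    (uniqueDiffOn_Ici (0 : ℝ) 0 (mem_Ici.2 le_rfl)).eq_deriv _ h1 h2

/-- Affinity of the flow on the segment from `p` to `q`, differentiated at time 0, makes `f` linear
along it; its slope is also the directional derivative of `f` at `p`. -/
theorem IsForwardEvolution.eq_fderiv_of_mem_recurrentSet [StrictConvexSpace ℝ E]
    (hf : ContDiff ℝ 1 f) (hXc : Convex ℝ X)
    (hφ : IsForwardEvolution f X φ) (hne : IsNonexpansiveEvolution X φ) {U : Filter ℝ} [U.NeBot]
    (hU : U ≤ atTop) {p q : E} (hp : p ∈ recurrentSet X φ U) (hfix : ∀ t, 0 ≤ t → φ t p = p)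
    (hq : q ∈ recurrentSet X φ U) : f q = fderiv ℝ f p (q - p) := by
  have hS := hφ.isNonexpansiveSemigroup hf hne
  have hfp := hφ.eq_zero_of_fixed hp.1 hfix
  have hray : ∀ c ∈ Icc (0 : ℝ) 1, f (AffineMap.lineMap p q c) = c • f q := by
    intro c hc
    have hm : AffineMap.lineMap p q c ∈ X := hXc.lineMap_mem hp.1 hq.1 hc
    have h1 := hφ.solution _ hm 0 (mem_Ici.2 le_rfl)
    have h2 : HasDerivWithinAt (fun t => φ t (AffineMap.lineMap p q c)) (c • f (φ 0 q)) (Ici 0) 0 := by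
      refine (((hφ.solution q hq.1 0 (mem_Ici.2 le_rfl)).sub_const p).const_smul c
        |>.add_const p).congr (fun t ht => ?_) ?_
      · rw [hS.apply_lineMap hXc hU hp hq ht hc, hfix t ht, AffineMap.lineMap_apply]
        simp
      · rw [hS.apply_lineMap hXc hU hp hq le_rfl hc, hfix 0 le_rfl, AffineMap.lineMap_apply]
        simp
    simpa [hφ.initial _ hm, hφ.initial _ hq.1] using
      (uniqueDiffOn_Ici (0 : ℝ) 0 (mem_Ici.2 le_rfl)).eq_deriv _ h1 h2
  have hline : HasDerivAt (fun c : ℝ => AffineMap.lineMap p q c) (q - p) 0 :=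
    AffineMap.hasDerivAt_lineMap
  have hfd : HasFDerivAt f (fderiv ℝ f p) (AffineMap.lineMap p q (0 : ℝ)) := by
    simpa using (hf.differentiable one_ne_zero p).hasFDerivAt
  have h1 := (hfd.comp_hasDerivAt (0 : ℝ) hline).hasDerivWithinAt (s := Icc 0 1)
  have h2 : HasDerivWithinAt (f ∘ fun c : ℝ => AffineMap.lineMap p q c) (f q) (Icc 0 1) 0 := by
    have := ((hasDerivAt_id (0 : ℝ)).smul_const (f q)).hasDerivWithinAt (s := Icc 0 1)
    rw [one_smul] at this
    exact this.congr hray (hray 0 (by simp))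
  exact ((uniqueDiffOn_Icc (zero_lt_one' ℝ) 0 (by simp)).eq_deriv _ h1 h2).symm

/-- On a closed convex state space, the recurrent part of a nonexpansive evolution with bounded
trajectories is conjugate by a translation to a recurrent linear system. -/
theorem IsForwardEvolution.exists_linear_model [FiniteDimensional ℝ E] [StrictConvexSpace ℝ E]
    (hf : ContDiff ℝ 1 f) (hX : IsClosed X) (hXc : Convex ℝ X) (hXne : X.Nonempty)
    (hφ : IsForwardEvolution f X φ) (hne : IsNonexpansiveEvolution X φ)
    (hb : ∀ x ∈ X, HasBoundedTrajectory φ x) :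
    ∃ (p : E) (B : E →L[ℝ] E) (U : Filter ℝ), U.NeBot ∧ U ≤ atTop ∧ f p = 0 ∧
      linearFlowRecurrentSubmodule B U = ⊤ ∧
      ∀ x ∈ X, (∃ y : E, omegaLimit atTop φ {x} =
          (fun z => p + z) '' omegaLimit atTop (linearFlow B) {y}) ∧
        ∀ q ∈ omegaLimit atTop φ {x}, f q = B (q - p) := by
  have : ProperSpace E := FiniteDimensional.proper_real E
  have : CompleteSpace E := FiniteDimensional.complete ℝ E
  have hS := hφ.isNonexpansiveSemigroup hf hne
  obtain ⟨U, hU, hidem⟩ := exists_ultrafilter_le_atTop_add_idempotent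
  have hnn : ∀ᶠ t in (U : Filter ℝ), (0 : ℝ) ≤ t := hU (eventually_ge_atTop 0)
  have hrec := fun x hx => hS.exists_recurrent_limit hX hb hU hidem (x := x) hx
  obtain ⟨x₀, hx₀⟩ := hXne
  obtain ⟨q₀, hq₀, -⟩ := hrec x₀ hx₀
  obtain ⟨p, hpX, hfix⟩ := hS.exists_fixedPoint hX hXc hU hq₀ (hb _ hq₀.1)
  have hp : p ∈ recurrentSet X φ U :=
    ⟨hpX, tendsto_const_nhds.congr' (hnn.mono fun t ht => (hfix t ht).symm)⟩
  let V : Submodule ℝ E := Submodule.span ℝ ((fun q => q - p) '' recurrentSet X φ U)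
  have hV : ∀ q ∈ recurrentSet X φ U, q - p ∈ V := fun q hq =>
    Submodule.subset_span (mem_image_of_mem _ hq)
  obtain ⟨π, hπ⟩ := Submodule.ClosedComplemented.of_finiteDimensional V
  -- The derivative at `p` itself may fail to be conserved off `V`, so it is replaced by zero on
  -- `ker π`, where the flow of `B` is then constant.
  let B : E →L[ℝ] E := fderiv ℝ f p ∘L V.subtypeL ∘L π
  have hBV : ∀ v ∈ V, B v = fderiv ℝ f p v := fun v hv => by
    simp [B, hπ ⟨v, hv⟩]
  have hfB : ∀ q ∈ recurrentSet X φ U, f q = B (q - p) := fun q hq => by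
    rw [hBV _ (hV q hq), hφ.eq_fderiv_of_mem_recurrentSet hf hXc hne hU hp hfix hq]
  have hflow : ∀ q ∈ recurrentSet X φ U, ∀ t, 0 ≤ t → φ t q - p = linearFlow B t (q - p) := by
    intro q hq t ht
    have hcurve : IsIntegralCurveOn (fun t => φ t q - p) (fun _ => B) (Ici 0) := by
      intro s hs
      have := (hφ.solution q hq.1 s hs).sub_const p
      simpa only [hfB _ (hS.apply_mem_recurrentSet hU hq hs)] using this
    have := hcurve.eqOn_linearFlow ht
    simpa only [hφ.initial q hq.1] using this
  have htop : linearFlowRecurrentSubmodule B U = ⊤ := by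
    have hVle : V ≤ linearFlowRecurrentSubmodule B U := by
      refine Submodule.span_le.2 ?_
      rintro _ ⟨q, hq, rfl⟩
      refine ⟨?_, (hq.2.sub_const p).congr' (hnn.mono fun t ht => hflow q hq t ht)⟩
      obtain ⟨C, hC⟩ := hasBoundedTrajectory_iff.1 (hb q hq.1)
      refine hasBoundedTrajectory_iff.2 ⟨C + ‖p‖, fun t ht => ?_⟩
      rw [← hflow q hq t ht]
      exact norm_sub_le_of_le (hC t ht) le_rfl
    have hker : ∀ y, π y = 0 → y ∈ linearFlowRecurrentSubmodule B U := by
      intro y hy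
      have hcurve : IsIntegralCurveOn (fun _ => y) (fun _ => B) (Ici 0) := fun s _ => by
        have : B y = 0 := by simp [B, hy]
        simpa only [this] using hasDerivWithinAt_const s (Ici 0) y
      have heq : ∀ t, 0 ≤ t → y = linearFlow B t y := fun t ht => hcurve.eqOn_linearFlow ht
      exact ⟨hasBoundedTrajectory_iff.2 ⟨‖y‖, fun t ht => (congrArg norm (heq t ht)).ge⟩,
        tendsto_const_nhds.congr' (hnn.mono fun t ht => heq t ht)⟩
    refine eq_top_iff.2 fun y _ => ?_
    have := add_mem (hVle (π y).2) (hker (y - π y) (by simp [hπ]))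
    simpa using this
  refine ⟨p, B, U, inferInstance, hU, ?_, htop, fun x hx => ?_⟩
  · exact hφ.eq_zero_of_fixed hpX hfix
  obtain ⟨q, hq, hlim⟩ := hrec x hx
  have hω := omegaLimit_eq_of_tendsto_dist (hS.tendsto_dist_atTop hU hx hq hlim)
  rw [hω]
  refine ⟨⟨q - p, ?_⟩, fun r hr => hfB r (hS.omegaLimit_subset_recurrentSet hU hX hq hr)⟩
  have h1 : omegaLimit atTop φ {q} =
      omegaLimit atTop (fun t z => p + linearFlow B t z) {q - p} := by
    refine omegaLimit_eq_of_tendsto_dist (tendsto_const_nhds.congr' ?_)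
    filter_upwards [eventually_ge_atTop 0] with t ht
    simp [← hflow q hq t ht]
  rw [h1]
  ext z
  simp only [mem_omegaLimit_singleton_iff_mapClusterPt, mem_image]
  constructor
  · intro h
    refine ⟨-p + z, ?_, by simp⟩
    simpa [Function.comp_def] using
      h.continuousAt_comp (f := fun w => -p + w) (by fun_prop)
  · rintro ⟨w, hw, rfl⟩
    simpa [Function.comp_def] using hw.continuousAt_comp (f := fun w => p + w) (by fun_prop)

end Evolution

/-! ### Kronecker's theorem by equidistribution. -/

section Kronecker

open MeasureTheory

theorem isClosed_setOf_tendsto_of_lipschitzWith {ι α β : Type*} [PseudoMetricSpace α]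
    [PseudoMetricSpace β] {l : Filter ι} {L : ι → α → β} {L₀ : α → β}
    (hL : ∀ i, LipschitzWith 1 (L i)) (hL₀ : LipschitzWith 1 L₀) :
    IsClosed {g | Tendsto (fun i => L i g) l (𝓝 (L₀ g))} := by
  refine isClosed_of_closure_subset fun g hg => Metric.tendsto_nhds.2 fun ε hε => ?_
  obtain ⟨b, hb, hgb⟩ := Metric.mem_closure_iff.1 hg (ε / 3) (by positivity)
  filter_upwards [Metric.tendsto_nhds.1 hb (ε / 3) (by positivity)] with i hi
  have h1 := (hL i).dist_le_mul g b
  have h2 := hL₀.dist_le_mul b g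
  have h3 := dist_triangle4 (L i g) (L i b) (L₀ b) (L₀ g)
  rw [dist_comm b g] at h2
  simp only [NNReal.coe_one, one_mul] at h1 h2
  linarith

variable {d : Type*}

/-- The linear flow line through the origin of the unit torus with frequency vector `μ`. -/
def UnitAddTorus.line (μ : d → ℝ) (t : ℝ) : UnitAddTorus d :=
  fun i => ((t * μ i : ℝ) : UnitAddCircle)

namespace UnitAddTorus

theorem continuous_line (μ : d → ℝ) : Continuous (line μ) :=
  continuous_pi fun i => (AddCircle.continuous_mk' 1).comp (by fun_prop)

variable [Fintype d]

theorem volume_real_univ : (volume : Measure (UnitAddTorus d)).real univ = 1 := by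
  rw [measureReal_def, volume_pi, Measure.pi_univ]
  simp

theorem mFourier_line (μ : d → ℝ) (n : d → ℤ) (t : ℝ) :
    mFourier n (line μ t) =
      Complex.exp ((2 * Real.pi * (∑ i, n i * μ i : ℝ) * Complex.I) * t) := by
  simp only [mFourier, line, ContinuousMap.coe_mk, fourier_coe_apply]
  rw [← Complex.exp_sum]
  congr 1
  push_cast
  rw [Finset.mul_sum, Finset.sum_mul, Finset.sum_mul]
  refine Finset.sum_congr rfl fun i _ => ?_
  ring

theorem mFourier_apply_add (n : d → ℤ) (x y : UnitAddTorus d) :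
    mFourier n (x + y) = mFourier n x * mFourier n y := by
  simp only [mFourier, ContinuousMap.coe_mk, Pi.add_apply, ← Finset.prod_mul_distrib]
  refine Finset.prod_congr rfl fun i _ => ?_
  simp [fourier_apply, AddCircle.toCircle_add]

variable {μ : d → ℝ}

/-- Translating along the line by half a period of the character changes its sign but not its
integral. -/
theorem integral_mFourier_eq_zero (hμ : ∀ n : d → ℤ, ∑ i, n i * μ i = 0 → n = 0) {n : d → ℤ}
    (hn : n ≠ 0) : ∫ x : UnitAddTorus d, mFourier n x = 0 := by
  have hs : ∑ i, n i * μ i ≠ 0 := fun h => hn (hμ n h)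
  have h1 : ∫ x : UnitAddTorus d, mFourier n (x + line μ (1 / (2 * ∑ i, n i * μ i))) =
      ∫ x : UnitAddTorus d, mFourier n x := integral_add_right_eq_self _ _
  have h2 : mFourier n (line μ (1 / (2 * ∑ i, n i * μ i))) = -1 := by
    rw [mFourier_line, ← Complex.exp_pi_mul_I]
    congr 1
    have hs' : ((∑ i, n i * μ i : ℝ) : ℂ) ≠ 0 := by exact_mod_cast hs
    rw [Complex.ofReal_div, Complex.ofReal_mul]
    field_simp
    simp
  simp only [mFourier_apply_add, h2, mul_neg, mul_one, integral_neg] at h1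
  exact self_eq_neg.1 h1.symm

theorem tendsto_average_line_mFourier (hμ : ∀ n : d → ℤ, ∑ i, n i * μ i = 0 → n = 0)
    (n : d → ℤ) :
    Tendsto (fun T : ℝ => (T⁻¹ : ℂ) * ∫ t in (0 : ℝ)..T, mFourier n (line μ t)) atTop
      (𝓝 (∫ x : UnitAddTorus d, mFourier n x)) := by
  rcases eq_or_ne n 0 with rfl | hn
  · refine tendsto_const_nhds.congr' ?_
    filter_upwards [eventually_gt_atTop 0] with T hT
    have : (T : ℂ) ≠ 0 := by exact_mod_cast hT.ne'
    simp [mFourier_zero, this, volume_real_univ]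
  rw [integral_mFourier_eq_zero hμ hn]
  have hs : ∑ i, n i * μ i ≠ 0 := fun h => hn (hμ n h)
  set c : ℂ := 2 * Real.pi * (∑ i, n i * μ i : ℝ) * Complex.I with hc
  have hc0 : c ≠ 0 := by
    have : ((∑ i, n i * μ i : ℝ) : ℂ) ≠ 0 := by exact_mod_cast hs
    simp [hc, this, Real.pi_ne_zero, -Complex.ofReal_sum]
  rw [tendsto_zero_iff_norm_tendsto_zero]
  refine squeeze_zero' (g := fun T : ℝ => T⁻¹ * (2 / ‖c‖))
    (Eventually.of_forall fun _ => norm_nonneg _) ?_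
    (by simpa using tendsto_inv_atTop_zero.mul_const (2 / ‖c‖))
  filter_upwards [eventually_gt_atTop 0] with T hT
  simp only [mFourier_line, ← hc]
  rw [integral_exp_mul_complex hc0, norm_mul, norm_inv, Complex.norm_real, Real.norm_of_nonneg hT.le,
    norm_div]
  gcongr
  refine (norm_sub_le _ _).trans ?_
  have : ∀ r : ℝ, ‖Complex.exp (c * r)‖ = 1 := fun r => by
    rw [Complex.norm_exp]
    simp [hc, -Complex.ofReal_sum]
  rw [this, this]
  norm_num

/-- Weyl's argument: the claim holds for characters, is linear in `g`, and passes to uniform limits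
because averages and integral are 1-Lipschitz. -/
theorem tendsto_average_line (hμ : ∀ n : d → ℤ, ∑ i, n i * μ i = 0 → n = 0)
    (g : C(UnitAddTorus d, ℂ)) :
    Tendsto (fun T : ℝ => (T⁻¹ : ℂ) * ∫ t in (0 : ℝ)..T, g (line μ t)) atTop
      (𝓝 (∫ x : UnitAddTorus d, g x)) := by
  have hint : ∀ (g : C(UnitAddTorus d, ℂ)) (T : ℝ),
      IntervalIntegrable (fun t => g (line μ t)) volume 0 T := fun g T =>
    (g.continuous.comp (continuous_line μ)).intervalIntegrable _ _
  have hint' : ∀ g : C(UnitAddTorus d, ℂ), Integrable (fun x => g x) volume := fun g =>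
    g.continuous.integrable_of_hasCompactSupport (HasCompactSupport.of_compactSpace _)
  have hclosed : IsClosed {g : C(UnitAddTorus d, ℂ) |
      Tendsto (fun T : ℝ => (T⁻¹ : ℂ) * ∫ t in (0 : ℝ)..T, g (line μ t)) atTop
      (𝓝 (∫ x : UnitAddTorus d, g x))} := by
    refine isClosed_setOf_tendsto_of_lipschitzWith
      (L := fun (T : ℝ) (g : C(UnitAddTorus d, ℂ)) => (T⁻¹ : ℂ) * ∫ t in (0 : ℝ)..T, g (line μ t))
      (L₀ := fun g => ∫ x, g x) (fun T => ?_) ?_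
    · refine LipschitzWith.of_dist_le_mul fun g h => ?_
      rw [dist_eq_norm, ← mul_sub, ← intervalIntegral.integral_sub (hint g T) (hint h T), norm_mul,
        NNReal.coe_one, one_mul]
      have := intervalIntegral.norm_integral_le_of_norm_le_const (a := 0) (b := T) (C := dist g h)
        (f := fun t => g (line μ t) - h (line μ t)) fun t _ => by
          rw [← dist_eq_norm]; exact ContinuousMap.dist_apply_le_dist _
      rw [sub_zero] at this
      rw [norm_inv, Complex.norm_real, Real.norm_eq_abs]
      rcases eq_or_ne T 0 with rfl | hT
      · simp
      · rw [inv_mul_le_iff₀ (abs_pos.2 hT)]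
        exact this.trans_eq (mul_comm _ _)
    · refine LipschitzWith.of_dist_le_mul fun g h => ?_
      rw [dist_eq_norm, ← integral_sub (hint' g) (hint' h), NNReal.coe_one, one_mul]
      refine (norm_integral_le_of_norm_le_const (C := dist g h)
        (Eventually.of_forall fun x => ?_)).trans_eq (by rw [volume_real_univ, mul_one])
      rw [← dist_eq_norm]; exact ContinuousMap.dist_apply_le_dist _
  have hspan : ∀ g ∈ Submodule.span ℂ (range (mFourier (d := d))),
      Tendsto (fun T : ℝ => (T⁻¹ : ℂ) * ∫ t in (0 : ℝ)..T, g (line μ t)) atTop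
      (𝓝 (∫ x : UnitAddTorus d, g x)) := by
    intro g hg
    induction hg using Submodule.span_induction with
    | mem g hg =>
      obtain ⟨n, rfl⟩ := hg
      exact tendsto_average_line_mFourier hμ n
    | zero => simp
    | add g h _ _ hg hh =>
      have := hg.add hh
      simp only [← mul_add, ← intervalIntegral.integral_add (hint g _) (hint h _),
        ← integral_add (hint' g) (hint' h)] at this
      exact this
    | smul c g _ hg =>
      simp only [ContinuousMap.smul_apply, smul_eq_mul, intervalIntegral.integral_const_mul,
        integral_const_mul, mul_left_comm _ c]
      exact hg.const_mul c
  have hmem : g ∈ (Submodule.span ℂ (range (mFourier (d := d)))).topologicalClosure := by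
    rw [span_mFourier_closure_eq_top]; trivial
  exact closure_minimal hspan hclosed hmem

/-- **Kronecker's theorem**: a line on the torus whose frequencies are linearly independent over
the integers accumulates at every point. -/
theorem mapClusterPt_line (hμ : ∀ n : d → ℤ, ∑ i, n i * μ i = 0 → n = 0) (z : UnitAddTorus d) :
    MapClusterPt z atTop (line μ) := by
  rw [mapClusterPt_iff_frequently]
  intro s hs hev
  obtain ⟨W, hWs, hW, hzW⟩ := mem_nhds_iff.1 hs
  -- If the line eventually avoids `W`, the time averages of the bump `F` tend to 0, against its
  -- positive integral.
  obtain ⟨F, hF0, hF1, hF⟩ := exists_continuous_zero_one_of_isClosed (s := Wᶜ) (t := {z})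
    hW.isClosed_compl isClosed_singleton (by simpa using hzW)
  have hpos : 0 < ∫ x : UnitAddTorus d, F x :=
    F.continuous.integral_pos_of_hasCompactSupport_nonneg_nonzero
      (HasCompactSupport.of_compactSpace _) (fun x => (hF x).1) (x := z) (by simp [hF1 rfl])
  let g : C(UnitAddTorus d, ℂ) := ⟨fun x => (F x : ℂ), by fun_prop⟩
  have h1 := tendsto_average_line hμ g
  obtain ⟨T₀, hT₀⟩ := eventually_atTop.1 hev
  have hcont : Continuous fun t => g (line μ t) := g.continuous.comp (continuous_line μ)
  have h2 : Tendsto (fun T : ℝ => (T⁻¹ : ℂ) * ∫ t in (0 : ℝ)..T, g (line μ t)) atTop (𝓝 0) := by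
    have : Tendsto (fun T : ℝ => ((T⁻¹ : ℝ) : ℂ) * ∫ t in (0 : ℝ)..T₀, g (line μ t)) atTop
        (𝓝 (((0 : ℝ) : ℂ) * ∫ t in (0 : ℝ)..T₀, g (line μ t))) :=
      ((Complex.continuous_ofReal.tendsto 0).comp tendsto_inv_atTop_zero).mul_const _
    rw [Complex.ofReal_zero, zero_mul] at this
    refine this.congr' ?_
    filter_upwards [eventually_ge_atTop T₀] with T hT
    rw [← intervalIntegral.integral_add_adjacent_intervals
      (hcont.intervalIntegrable 0 T₀) (hcont.intervalIntegrable T₀ T), Complex.ofReal_inv,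
      intervalIntegral.integral_congr (a := T₀) (b := T) (g := fun _ => 0)]
    · simp
    · intro t ht
      rw [uIcc_of_le hT] at ht
      have : F (line μ t) = 0 := hF0 fun h => hT₀ t ht.1 (hWs h)
      simp [g, this]
  have h3 := tendsto_nhds_unique h1 h2
  have h4 : ∫ x : UnitAddTorus d, g x = ((∫ x : UnitAddTorus d, F x : ℝ) : ℂ) := integral_ofReal
  rw [h4] at h3
  exact hpos.ne' (by exact_mod_cast h3)

end UnitAddTorus

end Kronecker

/-! ### Diagonalizing a recurrent linear flow. -/

section Eigenfunctionals

variable {E : Type*} [NormedAddCommGroup E] [NormedSpace ℝ E]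

/-- Precomposition with `B`, on complex-valued real-linear functionals. -/
noncomputable def precompComplexFunctional (B : E →L[ℝ] E) : Module.End ℂ (E →ₗ[ℝ] ℂ) where
  toFun l := l ∘ₗ (B : E →ₗ[ℝ] E)
  map_add' _ _ := rfl
  map_smul' _ _ := rfl

variable [FiniteDimensional ℝ E] {B : E →L[ℝ] E}

theorem hasDerivAt_functional_linearFlow (l : E →ₗ[ℝ] ℂ) (y : E) (t : ℝ) :
    HasDerivAt (fun s => l (linearFlow B s y))
      (precompComplexFunctional B l (linearFlow B t y)) t := by
  have : CompleteSpace E := FiniteDimensional.complete ℝ E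
  exact (LinearMap.toContinuousLinearMap l).hasFDerivAt.comp_hasDerivAt t
    (hasDerivAt_linearFlow B y t)

/-- The evolution of a functional in a Jordan block of size at most two. -/
theorem functional_linearFlow_eq_of_jordan {l h : E →ₗ[ℝ] ℂ} {c : ℂ}
    (hl : precompComplexFunctional B l = c • l + h) (hh : precompComplexFunctional B h = c • h)
    (y : E) (t : ℝ) : l (linearFlow B t y) = Complex.exp (c * t) * (l y + t * h y) := by
  have hexp : ∀ t : ℝ, HasDerivAt (fun s : ℝ => Complex.exp (-c * s))
      (Complex.exp (-c * t) * -c) t := fun t => by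
    simpa using ((Complex.ofRealCLM.hasDerivAt (x := t)).const_mul (-c)).cexp
  have key : ∀ {l h : E →ₗ[ℝ] ℂ}, precompComplexFunctional B l = c • l + h → ∀ t : ℝ,
      HasDerivAt (fun s : ℝ => Complex.exp (-c * s) * l (linearFlow B s y))
        (Complex.exp (-c * t) * h (linearFlow B t y)) t := by
    intro l h hl t
    refine ((hexp t).mul (hasDerivAt_functional_linearFlow l y t)).congr_deriv ?_
    rw [hl]
    simp only [LinearMap.add_apply, LinearMap.smul_apply, smul_eq_mul]
    ring
  have hconst : ∀ {g : ℝ → ℂ}, (∀ t, HasDerivAt g 0 t) → ∀ t, g t = g 0 := fun {g} hg t =>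
    is_const_of_deriv_eq_zero (fun t => (hg t).differentiableAt) (fun t => (hg t).deriv) t 0
  have h1 : ∀ t : ℝ, Complex.exp (-c * t) * h (linearFlow B t y) = h y := by
    intro t
    have := hconst (g := fun s : ℝ => Complex.exp (-c * s) * h (linearFlow B s y))
      (fun t => by simpa using key (l := h) (h := 0) (by rw [hh, add_zero]) t) t
    simpa [linearFlow_zero_left] using this
  have h2 : Complex.exp (-c * t) * l (linearFlow B t y) - t * h y = l y := by
    have := hconst (g := fun s : ℝ => Complex.exp (-c * s) * l (linearFlow B s y) - s * h y)
      (fun t => by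
        have := (key hl t).sub ((Complex.ofRealCLM.hasDerivAt (x := t)).mul_const (h y))
        refine this.congr_deriv ?_
        rw [h1]
        simp) t
    simpa [linearFlow_zero_left] using this
  rw [← h2, sub_add_cancel, ← mul_assoc, ← Complex.exp_add]
  simp

variable {U : Filter ℝ} [U.NeBot]

/-- Otherwise the norm of `l` along a trajectory decays to zero or blows up exponentially, and
cannot return to its initial value. -/
theorem re_eq_zero_of_eigenfunctional (hU : U ≤ atTop) (hB : linearFlowRecurrentSubmodule B U = ⊤)
    {l : E →ₗ[ℝ] ℂ} {c : ℂ} (hl : precompComplexFunctional B l = c • l) (h0 : l ≠ 0) :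
    c.re = 0 := by
  obtain ⟨y, hy⟩ : ∃ y, l y ≠ 0 := by
    by_contra! h
    exact h0 (LinearMap.ext h)
  have hy' : y ∈ linearFlowRecurrentSubmodule B U := hB ▸ Submodule.mem_top
  have h1 : Tendsto (fun t => ‖l (linearFlow B t y)‖) U (𝓝 ‖l y‖) :=
    (((LinearMap.continuous_of_finiteDimensional l).tendsto y).comp hy'.2).norm
  have h2 : ∀ t : ℝ, ‖l (linearFlow B t y)‖ = Real.exp (c.re * t) * ‖l y‖ := fun t => by
    rw [functional_linearFlow_eq_of_jordan (h := 0) (by rw [hl, add_zero]) (by simp) y t]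
    simp [Complex.norm_exp]
  simp only [h2] at h1
  have hpos : 0 < ‖l y‖ := norm_pos_iff.2 hy
  rcases lt_trichotomy c.re 0 with hc | hc | hc
  · have h3 : Tendsto (fun t : ℝ => Real.exp (c.re * t) * ‖l y‖) U (𝓝 (0 * ‖l y‖)) :=
      (Real.tendsto_exp_atBot.comp ((tendsto_id.const_mul_atTop_of_neg hc).mono_left hU)).mul_const _
    rw [zero_mul] at h3
    exact absurd (tendsto_nhds_unique h1 h3) hpos.ne'
  · exact hc
  · have h3 : Tendsto (fun t : ℝ => Real.exp (c.re * t) * ‖l y‖) U atTop :=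
      (Real.tendsto_exp_atTop.comp
        ((tendsto_id.const_mul_atTop hc).mono_left hU)).atTop_mul_const hpos
    exact absurd h1 (not_tendsto_nhds_of_tendsto_atTop h3 _)

/-- A nontrivial Jordan block on the imaginary axis would make `l` grow linearly, contradicting
recurrence. -/
theorem eigenfunctional_of_sub_sq (hU : U ≤ atTop) (hB : linearFlowRecurrentSubmodule B U = ⊤)
    {l h : E →ₗ[ℝ] ℂ} {c : ℂ} (hl : precompComplexFunctional B l = c • l + h)
    (hh : precompComplexFunctional B h = c • h) : h = 0 := by
  by_contra h0
  have hc := re_eq_zero_of_eigenfunctional hU hB hh h0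
  refine h0 (LinearMap.ext fun y => ?_)
  by_contra hy
  have hy' : y ∈ linearFlowRecurrentSubmodule B U := hB ▸ Submodule.mem_top
  have h1 : Tendsto (fun t => ‖l (linearFlow B t y)‖) U (𝓝 ‖l y‖) :=
    (((LinearMap.continuous_of_finiteDimensional l).tendsto y).comp hy'.2).norm
  refine not_tendsto_nhds_of_tendsto_atTop ?_ _ h1
  have hpos : 0 < ‖h y‖ := norm_pos_iff.2 hy
  have h3 : Tendsto (fun t : ℝ => t * ‖h y‖ - ‖l y‖) U atTop :=
    tendsto_atTop_add_const_right _ _ ((tendsto_id.mono_left hU).atTop_mul_const hpos)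
  refine tendsto_atTop_mono' U ?_ h3
  filter_upwards [hU (eventually_ge_atTop 0)] with t ht
  rw [functional_linearFlow_eq_of_jordan hl hh y t, norm_mul, Complex.norm_exp]
  have h4 := norm_sub_le_norm_add (t * h y : ℂ) (l y)
  rw [norm_mul, Complex.norm_real, Real.norm_of_nonneg ht, add_comm] at h4
  simpa [hc] using h4

theorem maxGenEigenspace_precompComplexFunctional (hU : U ≤ atTop)
    (hB : linearFlowRecurrentSubmodule B U = ⊤) (c : ℂ) {l : E →ₗ[ℝ] ℂ}
    (hl : l ∈ (precompComplexFunctional B).maxGenEigenspace c) :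
    precompComplexFunctional B l = c • l := by
  obtain ⟨k, hk⟩ := (Module.End.mem_maxGenEigenspace _ _ _).1 hl
  set N := precompComplexFunctional B - c • 1 with hN
  have hNapp : ∀ l, N l = precompComplexFunctional B l - c • l := fun l => by simp [hN]
  have hsq : ∀ l, N (N l) = 0 → N l = 0 := by
    intro l hl
    refine eigenfunctional_of_sub_sq hU hB (l := l) (c := c) ?_ ?_
    · rw [hNapp, add_sub_cancel]
    · rw [← sub_eq_zero, ← hNapp, hl]
  have hall : ∀ k, ∀ l, (N ^ k) l = 0 → N l = 0 := by
    intro k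
    induction k with
    | zero => intro l hl; rw [pow_zero, Module.End.one_apply] at hl; rw [hl, map_zero]
    | succ k ih =>
      intro l hl
      rw [pow_succ, Module.End.mul_apply] at hl
      exact hsq l (ih _ hl)
  rw [← sub_eq_zero, ← hNapp]
  exact hall k l hk

/-- A recurrent linear system on a finite-dimensional space is diagonalized by finitely many
complex functionals, which separate points and rotate with constant frequencies. -/
theorem exists_rotating_functionals (hU : U ≤ atTop)
    (hB : linearFlowRecurrentSubmodule B U = ⊤) :
    ∃ (N : ℕ) (l : Fin N → E →ₗ[ℝ] ℂ) (a : Fin N → ℝ),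
      (∀ j t y, l j (linearFlow B t y) =
        Complex.exp (2 * Real.pi * Complex.I * (t * a j : ℝ)) * l j y) ∧
      ∀ y, (∀ j, l j y = 0) → y = 0 := by
  let s : Set (E →ₗ[ℝ] ℂ) :=
    {l | ∃ a : ℝ, precompComplexFunctional B l = (2 * Real.pi * Complex.I * a : ℂ) • l}
  have hs : Submodule.span ℂ s = ⊤ := by
    rw [eq_top_iff, ← Module.End.iSup_maxGenEigenspace_eq_top (precompComplexFunctional B)]
    refine iSup_le fun c l hl => ?_
    have hlc := maxGenEigenspace_precompComplexFunctional hU hB c hl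
    rcases eq_or_ne l 0 with rfl | h0
    · exact zero_mem _
    refine Submodule.subset_span ⟨c.im / (2 * Real.pi), ?_⟩
    rw [hlc]
    congr 1
    have hre := re_eq_zero_of_eigenfunctional hU hB hlc h0
    rw [← Complex.re_add_im c, hre]
    have : (Real.pi : ℂ) ≠ 0 := by exact_mod_cast Real.pi_ne_zero
    push_cast
    field_simp
    simp [mul_comm]
  obtain ⟨l, hl, hspan, -⟩ := Submodule.exists_fun_fin_finrank_span_eq ℂ s
  choose a ha using hl
  refine ⟨_, l, a, fun j t y => ?_, fun y hy => ?_⟩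
  · rw [functional_linearFlow_eq_of_jordan (h := 0) (by rw [ha j, add_zero]) (by simp) y t]
    simp only [LinearMap.zero_apply, mul_zero, add_zero]
    congr 2
    push_cast
    ring
  · have hspan := hspan.trans hs
    have hall : ∀ g : E →ₗ[ℝ] ℂ, g y = 0 := by
      intro g
      have hg : g ∈ Submodule.span ℂ (range l) := hspan ▸ Submodule.mem_top
      induction hg using Submodule.span_induction with
      | mem g hg => obtain ⟨j, rfl⟩ := hg; exact hy j
      | zero => rfl
      | add g h _ _ hg hh => simp [hg, hh]
      | smul c g _ hg => simp [hg]
    refine (Module.forall_dual_apply_eq_zero_iff ℝ y).1 fun g => ?_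
    simpa using hall (Complex.ofRealCLM.toLinearMap ∘ₗ g)

end Eigenfunctionals

/-! ### Limit sets of recurrent linear flows are tori. -/

section Torus

/-- If `G` is a continuous injection of a compact space and the curve `γ` accumulates everywhere,
then the limit set of `G ∘ γ` is homeomorphic to the compact space. -/
theorem nonempty_homeomorph_omegaLimit_of_eq_comp {K E : Type*} [TopologicalSpace K]
    [CompactSpace K] [TopologicalSpace E] [T2Space E] {γ : ℝ → K}
    (hγ : ∀ z, MapClusterPt z atTop γ) {G : K → E} (hG : Continuous G)
    (hinj : Function.Injective G) {φ : ℝ → E → E} {y : E} (h : ∀ t, φ t y = G (γ t)) :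
    Nonempty (omegaLimit atTop φ {y} ≃ₜ K) := by
  have hrange : omegaLimit atTop φ {y} = range G := by
    ext z
    rw [mem_omegaLimit_singleton_iff_mapClusterPt]
    simp only [h]
    constructor
    · intro hz
      refine (isCompact_range hG).isClosed.closure_subset_iff.2 subset_rfl
        (mem_closure_iff_frequently.2 ?_)
      have := mapClusterPt_iff_frequently.1 hz
      rw [frequently_iff]
      intro s hs
      obtain ⟨t, ht⟩ := (this s hs).exists
      exact ⟨_, ht, mem_range_self _⟩
    · rintro ⟨k, rfl⟩
      exact (hγ k).continuousAt_comp hG.continuousAt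
  rw [hrange]
  exact ⟨(hG.isClosedEmbedding hinj).isEmbedding.toHomeomorph.symm⟩

variable {E : Type*} [NormedAddCommGroup E] [NormedSpace ℝ E] [FiniteDimensional ℝ E]
  {B : E →L[ℝ] E} {U : Filter ℝ} [U.NeBot]

theorem nonempty_homeomorph_omegaLimit_linearFlow (hU : U ≤ atTop)
    (hB : linearFlowRecurrentSubmodule B U = ⊤) (y : E) :
    ∃ k : ℕ, Nonempty (omegaLimit atTop (linearFlow B) {y} ≃ₜ (Fin k → Circle)) := by
  classical
  obtain ⟨N, l, a₀, hl₀, hsep⟩ := exists_rotating_functionals hU hB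
  -- Frequencies of coordinates vanishing at `y` are discarded: they would add torus directions
  -- invisible to the orbit and spoil injectivity of `Ψ`.
  let a : Fin N → ℝ := fun j => if l j y = 0 then 0 else a₀ j
  have hl : ∀ j t, l j (linearFlow B t y) =
      Complex.exp (2 * Real.pi * Complex.I * (t * a j : ℝ)) * l j y := by
    intro j t
    rw [hl₀]
    by_cases hj : l j y = 0
    · simp [hj]
    · simp [a, hj]
  -- Finitely generated and torsion-free, hence free; a basis provides integrally independent
  -- frequencies `μ`, and the torus is the group of characters of `Λ`.
  let Λ : Submodule ℤ ℝ := Submodule.span ℤ (range a)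
  have : Module.Finite ℤ Λ := Module.Finite.span_of_finite ℤ (finite_range a)
  have : Module.Free ℤ Λ := inferInstance
  let b := Module.finBasis ℤ Λ
  let μ : Fin (Module.finrank ℤ Λ) → ℝ := fun i => b i
  have hμ : ∀ n : Fin (Module.finrank ℤ Λ) → ℤ, ∑ i, n i * μ i = 0 → n = 0 := by
    intro n hn
    have h1 : ∑ i, n i • b i = 0 := by
      apply Subtype.ext
      simpa [μ] using hn
    exact funext fun i => Fintype.linearIndependent_iff.1 b.linearIndependent n h1 i
  let α : Fin N → Λ := fun j => ⟨a j, Submodule.subset_span (mem_range_self j)⟩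
  let χ : UnitAddTorus (Fin (Module.finrank ℤ Λ)) → Λ →ₗ[ℤ] UnitAddCircle := fun θ =>
    b.constr ℤ θ
  have hχ : ∀ v, Continuous fun θ => χ θ v := fun v => by
    simp only [χ, Module.Basis.constr_apply_fintype]
    fun_prop
  have hχline : ∀ t v, χ (UnitAddTorus.line μ t) v = ((t * (v : ℝ) : ℝ) : UnitAddCircle) := by
    intro t v
    let ρ : Λ →ₗ[ℤ] UnitAddCircle := (((QuotientAddGroup.mk' _).comp
      (AddMonoidHom.mulLeft t)).comp Λ.toAddSubgroup.subtype).toIntLinearMap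
    have : χ (UnitAddTorus.line μ t) = ρ := b.ext fun i => by
      rw [Module.Basis.constr_basis]
      rfl
    rw [this]
    rfl
  let Ψ : UnitAddTorus (Fin (Module.finrank ℤ Λ)) → Fin N → ℂ := fun θ j =>
    (AddCircle.toCircle (χ θ (α j)) : ℂ) * l j y
  have hΨ : Continuous Ψ := continuous_pi fun j =>
    (continuous_subtype_val.comp (AddCircle.continuous_toCircle.comp (hχ _))).mul continuous_const
  have hΨinj : Function.Injective Ψ := by
    intro θ θ' h
    have h1 : ∀ j, χ θ (α j) = χ θ' (α j) := by
      intro j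
      by_cases hj : l j y = 0
      · have : α j = 0 := Subtype.ext (by simp [α, a, hj])
        simp [this]
      · exact AddCircle.injective_toCircle one_ne_zero
          (Circle.ext (mul_right_cancel₀ hj (congrFun h j)))
    have hspan : Submodule.span ℤ (range α) = ⊤ := by
      have := Submodule.span_span_coe_preimage (R := ℤ) (s := range a)
      have hα : range α = Subtype.val ⁻¹' range a := Set.ext fun v =>
        exists_congr fun j => Subtype.ext_iff
      rw [hα]
      exact this
    have h2 : χ θ = χ θ' := LinearMap.ext_on_range hspan h1
    ext i
    have := LinearMap.congr_fun h2 (b i)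
    simpa only [χ, Module.Basis.constr_basis] using this
  let Φ : E →ₗ[ℝ] (Fin N → ℂ) := LinearMap.pi l
  have hΦker : LinearMap.ker Φ = ⊥ := by
    rw [LinearMap.ker_eq_bot']
    exact fun v hv => hsep v fun j => congrFun hv j
  obtain ⟨π, hπ⟩ := LinearMap.exists_leftInverse_of_injective Φ hΦker
  have hπΦ : ∀ v, π (Φ v) = v := fun v => LinearMap.congr_fun hπ v
  have hπc : Continuous π := LinearMap.continuous_of_finiteDimensional π
  have hΦc : Continuous Φ := LinearMap.continuous_of_finiteDimensional Φ
  have hflow : ∀ t, Φ (linearFlow B t y) = Ψ (UnitAddTorus.line μ t) := by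
    intro t
    ext j
    simp only [Φ, Ψ, LinearMap.pi_apply, hl, hχline, α]
    congr 1
    rw [AddCircle.toCircle_apply_mk, Circle.coe_exp]
    congr 1
    push_cast
    ring
  have hcl := UnitAddTorus.mapClusterPt_line hμ
  have hdense : Dense (range (UnitAddTorus.line μ)) := by
    intro z
    rw [mem_closure_iff_nhds]
    intro s hs
    obtain ⟨t, ht⟩ := (mapClusterPt_iff_frequently.1 (hcl z) s hs).exists
    exact ⟨_, ht, mem_range_self t⟩
  -- `Ψ` takes values in the range of `Φ`: this is clear on the dense line and follows everywhere by
  -- continuity. Hence `π ∘ Ψ` inherits injectivity from `Ψ`.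
  have hΦπ : (fun θ => Φ (π (Ψ θ))) = Ψ := by
    refine Continuous.ext_on hdense (hΦc.comp (hπc.comp hΨ)) hΨ ?_
    rintro _ ⟨t, rfl⟩
    simp only [← hflow, hπΦ]
  refine ⟨Module.finrank ℤ Λ, ?_⟩
  obtain ⟨e⟩ := nonempty_homeomorph_omegaLimit_of_eq_comp hcl (G := fun θ => π (Ψ θ))
    (hπc.comp hΨ) (fun θ θ' h => hΨinj (by
      rw [← congrFun hΦπ θ, ← congrFun hΦπ θ']; exact congrArg Φ h))
    (φ := linearFlow B) (y := y) (fun t => by rw [← hflow, hπΦ])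
  exact ⟨e.trans (Homeomorph.piCongrRight fun _ => AddCircle.homeomorphCircle one_ne_zero)⟩

end Torus

theorem mainTheorem1 {E : Type*} [NormedAddCommGroup E] [NormedSpace ℝ E]
    [FiniteDimensional ℝ E] [StrictConvexSpace ℝ E]
    (f : E → E) (hf : ContDiff ℝ 1 f) (X : Set E) (hX : Convex ℝ X) (φ : ℝ → E → E)
    (hφ : IsForwardEvolution f X φ) (hne : IsNonexpansiveEvolution X φ)
    (hbdd : ∃ x ∈ X, HasBoundedTrajectory φ x) :
    (∀ x ∈ X, HasBoundedTrajectory φ x) ∧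
    (∃ (p : E) (B : E →L[ℝ] E), f p = 0 ∧ IsConserved B ∧
      ∀ x ∈ X,
        (∃ y : E, omegaLimit atTop φ {x} =
          (fun z => p + z) '' omegaLimit atTop (linearFlow B) {y}) ∧
        ∀ q ∈ omegaLimit atTop φ {x}, f q = B (q - p)) ∧
    (∀ x ∈ X, ∃ k : ℕ, Nonempty (omegaLimit atTop φ {x} ≃ₜ (Fin k → Circle))) := by
  obtain ⟨x₀, hx₀, hb₀⟩ := hbdd
  -- Closedness is needed for the recurrent limits and the Chebyshev centre, which may lie outside
  -- `X`.
  obtain ⟨ψ, hψ, hψne, hψφ⟩ := hφ.exists_extension_closure hf.continuous hne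
  have hb₀' : HasBoundedTrajectory ψ x₀ := by
    rw [hasBoundedTrajectory_iff] at hb₀ ⊢
    obtain ⟨C, hC⟩ := hb₀
    exact ⟨C, fun t ht => by rw [hψφ t ht x₀ hx₀]; exact hC t ht⟩
  have hω : ∀ x ∈ X, omegaLimit atTop φ {x} = omegaLimit atTop ψ {x} := fun x hx =>
    omegaLimit_eq_of_tendsto_dist (tendsto_const_nhds.congr' (by
      filter_upwards [eventually_ge_atTop 0] with t ht
      rw [hψφ t ht x hx, dist_self]))
  obtain ⟨p, B, U, _, hU, hp, hB, hmodel⟩ := hψ.exists_linear_model hf isClosed_closure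
    hX.closure ⟨x₀, subset_closure hx₀⟩ hψne
    (fun x hx => hψ.hasBoundedTrajectory hψne (subset_closure hx₀) hx hb₀')
  refine ⟨fun x hx => hφ.hasBoundedTrajectory hne hx₀ hx hb₀,
    ⟨p, B, hp, isConserved_of_recurrent hU hB, fun x hx => ?_⟩, fun x hx => ?_⟩
  · rw [hω x hx]
    exact hmodel x (subset_closure hx)
  · obtain ⟨⟨y, hy⟩, -⟩ := hmodel x (subset_closure hx)
    obtain ⟨k, ⟨e⟩⟩ := nonempty_homeomorph_omegaLimit_linearFlow hU hB y
    rw [hω x hx, hy]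
    exact ⟨k, ⟨((Homeomorph.addLeft p).image _).symm.trans e⟩⟩
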